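/- Let $X$ be a real Hausdorff locally convex space with topological dual $X^*$. For $A \subseteq X$, $x \in A$ and $\varepsilon \ge 0$, let $$N^{\varepsilon}_A(x) := \partial_\varepsilon \delta_A(x) = \{x^* \in X^* : \langle x^*, y - x\rangle \le \varepsilon \text{ for all } y \in A\}$$ be the $\varepsilon$-normal set of $A$ at $x$, i.e. the $\varepsilon$-subdifferential at $x$ of the indicator function $\delta_A$ (equal to $0$ on $A$ and to $+\infty$ off $A$). Let $\{C_t : t \in T\}$ be a nonempty family (with $T$ an arbitrary nonempty index set) of closed convex subsets of $X$ and let $C := \bigcap_{t\in T} C_t$. Then for every $\varepsilon \ge 0$ and every $x \in C$, $$N^{\varepsilon}_C(x) = \bigcap_{\gamma > 0} \operatorname{cl} \bigcup \Big\{ \sum_{t \in A} N^{\eta_t}_{C_t}(x) \; : \; A \subseteq T \text{ finite},\ \eta_t \ge 0 \ (t \in A),\ \sum_{t\in A} \eta_t = \varepsilon + \gamma \Big\},$$ where the sums are Minkowski sums. The closure $\operatorname{cl}$ may be taken in the weak-$*$ topology $w(X^*,X)$, and equally in any other locally convex topology on $X^*$ compatible with the duality, i.e. one whose continuous linear functionals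 are exactly the evaluations $x^* \mapsto \langle x^*, x\rangle$, $x \in X$ (for instance the Mackey topology $\tau(X^*,X)$). -/

import Mathlib

open scoped Topology Pointwise

noncomputable section

/-- The indicator function of a set: `0` on the set and `+∞` off it. -/
def indicatorFun {X : Type*} (A : Set X) (x : X) : EReal :=
  open Classical in if x ∈ A then 0 else ⊤

section Dual

variable {X : Type*} [AddCommGroup X] [Module ℝ X] [TopologicalSpace X]

/-- The `ε`-subdifferential of `f : X → [-∞, ∞]` at `x`, a subset of the topological dual of `X`;
it is empty when `f x` is not finite. -/
def epsSubdifferential (ε : ℝ) (f : X → EReal) (x : X) : Set (WeakDual ℝ X) :=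
  {φ | f x ≠ ⊥ ∧ f x ≠ ⊤ ∧ ∀ y : X, ((φ (y - x) : ℝ) : EReal) ≤ f y - f x + (ε : EReal)}

/-- The `ε`-normal set of `A` at `x`: the `ε`-subdifferential of the indicator function. -/
def epsNormalSet (ε : ℝ) (A : Set X) (x : X) : Set (WeakDual ℝ X) :=
  epsSubdifferential ε (indicatorFun A) x

/-- The union of all Minkowski sums `∑ t ∈ A, N^{η t}_{C t}(x)` over finite sets `A` of indices and
nonnegative `η t`, `t ∈ A`, with `∑ t ∈ A, η t = r`. -/
def finiteNormalSums {T : Type*} (C : T → Set X) (x : X) (r : ℝ) : Set (WeakDual ℝ X) :=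
  {φ | ∃ (A : Finset T) (η : T → ℝ), (∀ t ∈ A, 0 ≤ η t) ∧ ∑ t ∈ A, η t = r ∧
    φ ∈ ∑ t ∈ A, epsNormalSet (η t) (C t) x}

/-- A topology `σ` on the dual `X*` is compatible with the duality `(X*, X)`: it is a locally convex
vector space topology whose continuous linear functionals are exactly the evaluations at points
of `X`. (It is automatically Hausdorff.) The weak-* and the Mackey topology are examples. -/
structure IsCompatibleTopology (σ : TopologicalSpace (WeakDual ℝ X)) : Prop where
  addGroup : @IsTopologicalAddGroup (WeakDual ℝ X) σ _
  smul : @ContinuousSMul ℝ (WeakDual ℝ X) _ _ σ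
  locallyConvex : @LocallyConvexSpace ℝ (WeakDual ℝ X) _ _ _ _ σ
  dual : ∀ Φ : WeakDual ℝ X →ₗ[ℝ] ℝ, Continuous[σ, inferInstance] Φ ↔
    ∃ x : X, ∀ φ : WeakDual ℝ X, Φ φ = φ x

end Dual

end

/-!
Fix `x ∈ C`. For `r > 0` the set `N^r_D(x)` is `r` times the polar of `D - x`, so by the bipolar
theorem it determines a closed convex `D ∋ x`: a point `y` lies in `D` if and only if
`φ (y - x) ≤ r` for all `φ ∈ N^r_D(x)`. Let `S_r` be the union of the finite sums with
`∑ η t = r`. It is convex, contains every `N^r_{C t}(x)`, and lies in `N^r_C(x)`. If `ψ z ≤ c` for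
all `ψ ∈ S_r`, then `0 ≤ c`, and for `d > c` the point `x + (r / d) • z` belongs to every `C t`,
hence to `C`, so every `φ ∈ N^r_C(x)` satisfies `φ z ≤ d`. Thus `S_r` and `N^r_C(x)` lie in the
same half-spaces defined by evaluations, which by Hahn-Banach means `N^r_C(x) = cl S_r` in any
compatible topology. Finally, `N^ε_C(x)` is the intersection of the sets `N^{ε + γ}_C(x)` over
`γ > 0`; the enlargement by `γ` only matters when `ε = 0`, where there is no scale for polarity.
-/

theorem finsupp_degree_eq_sum_of_support_subset {T M : Type*} [AddCommMonoid M] (f : T →₀ M)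
    {A : Finset T} (hA : f.support ⊆ A) : f.degree = ∑ t ∈ A, f t :=
  Finsupp.sum_of_support_subset f hA (fun _ m ↦ m) fun _ _ ↦ rfl

theorem finsupp_degree_indicator {T M : Type*} [AddCommMonoid M] (A : Finset T) (f : T → M) :
    (Finsupp.indicator A fun t _ ↦ f t).degree = ∑ t ∈ A, f t :=
  Finsupp.sum_indicator_index (h := fun _ m ↦ m) f fun _ _ ↦ rfl

theorem mem_closure_iff_forall_continuous_linearMap_le {E : Type*} [AddCommGroup E] [Module ℝ E]
    [TopologicalSpace E] [IsTopologicalAddGroup E] [ContinuousSMul ℝ E] [LocallyConvexSpace ℝ E]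
    {S : Set E} (hS : Convex ℝ S) {a : E} :
    a ∈ closure S ↔
      ∀ f : E →ₗ[ℝ] ℝ, Continuous f → ∀ c : ℝ, (∀ b ∈ S, f b ≤ c) → f a ≤ c := by
  constructor
  · exact fun ha f hf c hc ↦ closure_minimal hc (isClosed_le hf continuous_const) ha
  · intro h
    by_contra ha
    obtain ⟨f, u, hfS, hfa⟩ := geometric_hahn_banach_closed_point hS.closure isClosed_closure ha
    exact (h f f.continuous u fun b hb ↦ (hfS b (subset_closure hb)).le).not_gt hfa

section EpsSubdifferential

variable {X : Type*} [AddCommGroup X] [Module ℝ X] [TopologicalSpace X]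

theorem epsSubdifferential_eq_iInter_add (ε : ℝ) (f : X → EReal) (x : X) :
    epsSubdifferential ε f x = ⋂ γ : ℝ, ⋂ _ : 0 < γ, epsSubdifferential (ε + γ) f x := by
  ext φ
  simp only [epsSubdifferential, Set.mem_ofPred_eq, Set.mem_iInter]
  constructor
  · rintro ⟨hbot, htop, h⟩ γ hγ
    exact ⟨hbot, htop, fun y ↦ (h y).trans <|
      add_le_add_right (EReal.coe_le_coe (le_add_of_nonneg_right hγ.le)) _⟩
  · intro h
    refine ⟨(h 1 one_pos).1, (h 1 one_pos).2.1, fun y ↦ ?_⟩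
    have hy (γ : ℝ) (hγ : 0 < γ) := (h γ hγ).2.2 y
    generalize f y - f x = a at hy ⊢
    induction a with
    | bot => simpa using hy 1 one_pos
    | top => simp
    | coe a =>
      norm_cast at hy ⊢
      exact le_of_forall_pos_le_add fun γ hγ ↦ by linarith [hy γ hγ]

end EpsSubdifferential

section EpsNormalSet

variable {X : Type*} [AddCommGroup X] [Module ℝ X] [TopologicalSpace X]
  {A B : Set X} {x : X} {ε δ : ℝ} {φ ψ : WeakDual ℝ X}

theorem mem_epsNormalSet (hx : x ∈ A) :
    φ ∈ epsNormalSet ε A x ↔ ∀ y ∈ A, φ (y - x) ≤ ε := by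
  simp only [epsNormalSet, epsSubdifferential, indicatorFun, Set.mem_ofPred_eq, if_pos hx]
  constructor
  · rintro ⟨-, -, h⟩ y hy
    simpa [hy, -map_sub, ← EReal.coe_le_coe_iff] using h y
  · refine fun h ↦ ⟨by simp, by simp, fun y ↦ ?_⟩
    by_cases hy : y ∈ A
    · simpa [hy, -map_sub, ← EReal.coe_le_coe_iff] using h y hy
    · simp [hy]

theorem zero_mem_epsNormalSet (hx : x ∈ A) (hε : 0 ≤ ε) : 0 ∈ epsNormalSet ε A x :=
  (mem_epsNormalSet hx).2 fun _ _ ↦ hε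

theorem add_mem_epsNormalSet (hx : x ∈ A) (hφ : φ ∈ epsNormalSet ε A x)
    (hψ : ψ ∈ epsNormalSet δ A x) : φ + ψ ∈ epsNormalSet (ε + δ) A x := by
  rw [mem_epsNormalSet hx] at hφ hψ ⊢
  exact fun y hy ↦ add_le_add (hφ y hy) (hψ y hy)

theorem smul_mem_epsNormalSet (hx : x ∈ A) {a : ℝ} (ha : 0 ≤ a) (hφ : φ ∈ epsNormalSet ε A x) :
    a • φ ∈ epsNormalSet (a * ε) A x := by
  rw [mem_epsNormalSet hx] at hφ ⊢
  exact fun y hy ↦ mul_le_mul_of_nonneg_left (hφ y hy) ha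

theorem sum_mem_epsNormalSet {T : Type*} (hx : x ∈ A) {s : Finset T} {η : T → ℝ}
    {g : T → WeakDual ℝ X} (hg : ∀ t ∈ s, g t ∈ epsNormalSet (η t) A x) :
    ∑ t ∈ s, g t ∈ epsNormalSet (∑ t ∈ s, η t) A x := by
  induction s using Finset.cons_induction with
  | empty => simpa using zero_mem_epsNormalSet hx le_rfl
  | cons t s ht ih =>
    rw [Finset.forall_mem_cons] at hg
    simpa only [Finset.sum_cons] using add_mem_epsNormalSet hx hg.1 (ih hg.2)

theorem epsNormalSet_anti (hx : x ∈ A) (hAB : A ⊆ B) :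
    epsNormalSet ε B x ⊆ epsNormalSet ε A x := by
  intro φ hφ
  rw [mem_epsNormalSet (hAB hx)] at hφ
  exact (mem_epsNormalSet hx).2 fun y hy ↦ hφ y (hAB hy)

/-- The bipolar theorem, since `epsNormalSet r D x` is `r` times the polar of `D - x`. -/
theorem mem_iff_forall_epsNormalSet_apply_sub_le [IsTopologicalAddGroup X] [ContinuousSMul ℝ X]
    [LocallyConvexSpace ℝ X] {D : Set X} (hclosed : IsClosed D) (hconvex : Convex ℝ D)
    (hx : x ∈ D) {r : ℝ} (hr : 0 < r) {y : X} :
    y ∈ D ↔ ∀ φ ∈ epsNormalSet r D x, φ (y - x) ≤ r := by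
  refine ⟨fun hy φ hφ ↦ (mem_epsNormalSet hx).1 hφ y hy, fun h ↦ ?_⟩
  by_contra hy
  obtain ⟨f, u, hfD, hfy⟩ := geometric_hahn_banach_closed_point hconvex hclosed hy
  have hgap : 0 < u - f x := sub_pos.2 (hfD x hx)
  have scaled_apply (w : X) :
      ((r / (u - f x)) • f) (w - x) = r * ((f w - f x) / (u - f x)) := by
    simp only [smul_apply, map_sub, smul_eq_mul]
    ring
  have scaled_mem : StrongDual.toWeakDual ((r / (u - f x)) • f) ∈ epsNormalSet r D x := by
    refine (mem_epsNormalSet hx).2 fun w hw ↦ (scaled_apply w).trans_le ?_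
    refine mul_le_of_le_one_right hr.le ((div_le_one hgap).2 ?_)
    linarith [hfD w hw]
  have scaled_gt : r < ((r / (u - f x)) • f) (y - x) := by
    rw [scaled_apply]
    refine lt_mul_of_one_lt_right hr ((one_lt_div hgap).2 ?_)
    linarith
  exact (h _ scaled_mem).not_gt scaled_gt

end EpsNormalSet

section FiniteNormalSums

variable {X : Type*} [AddCommGroup X] [Module ℝ X] [TopologicalSpace X]
  {T : Type*} {C : T → Set X} {x : X} {r s : ℝ} {φ ψ : WeakDual ℝ X}

theorem epsNormalSet_subset_finiteNormalSums (hr : 0 ≤ r) (t : T) :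
    epsNormalSet r (C t) x ⊆ finiteNormalSums C x r :=
  fun φ hφ ↦ ⟨{t}, fun _ ↦ r, fun _ _ ↦ hr, by simp, by simpa using hφ⟩

theorem finiteNormalSums_subset_epsNormalSet_iInter (hx : x ∈ ⋂ t, C t) :
    finiteNormalSums C x r ⊆ epsNormalSet r (⋂ t, C t) x := by
  rintro φ ⟨A, η, -, rfl, hφ⟩
  obtain ⟨g, hg, rfl⟩ := (Set.mem_finsetSum _ _ _).1 hφ
  exact sum_mem_epsNormalSet hx fun t ht ↦
    epsNormalSet_anti hx (Set.iInter_subset C t) (hg ht)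

-- Extending `η` and the summands by zero frees the sums from their index sets.
theorem mem_finiteNormalSums_iff_finsupp (hx : ∀ t, x ∈ C t) :
    φ ∈ finiteNormalSums C x r ↔ ∃ (η : T →₀ ℝ) (g : T →₀ WeakDual ℝ X),
      (∀ t, 0 ≤ η t) ∧ (∀ t, g t ∈ epsNormalSet (η t) (C t) x) ∧ η.degree = r ∧ g.degree = φ := by
  classical
  constructor
  · rintro ⟨A, η, hη, rfl, hφ⟩
    obtain ⟨g, hg, rfl⟩ := (Set.mem_finsetSum _ _ _).1 hφ
    refine ⟨.indicator A fun t _ ↦ η t, .indicator A fun t _ ↦ g t, fun t ↦ ?_, fun t ↦ ?_,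
      finsupp_degree_indicator A η, finsupp_degree_indicator A g⟩ <;> by_cases ht : t ∈ A
    · simpa only [Finsupp.indicator_of_mem ht] using hη t ht
    · simp only [Finsupp.indicator_of_notMem ht, le_refl]
    · simpa only [Finsupp.indicator_of_mem ht] using hg ht
    · simpa only [Finsupp.indicator_of_notMem ht] using zero_mem_epsNormalSet (hx t) le_rfl
  · rintro ⟨η, g, hη, hg, rfl, rfl⟩
    refine ⟨η.support ∪ g.support, η, fun t _ ↦ hη t,
      (finsupp_degree_eq_sum_of_support_subset η Finset.subset_union_left).symm, ?_⟩
    rw [finsupp_degree_eq_sum_of_support_subset g Finset.subset_union_right]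
    exact Set.finsetSum_mem_finsetSum _ _ _ fun t _ ↦ hg t

theorem add_mem_finiteNormalSums (hx : ∀ t, x ∈ C t) (hφ : φ ∈ finiteNormalSums C x r)
    (hψ : ψ ∈ finiteNormalSums C x s) : φ + ψ ∈ finiteNormalSums C x (r + s) := by
  rw [mem_finiteNormalSums_iff_finsupp hx] at hφ hψ ⊢
  obtain ⟨η, g, hη, hg, rfl, rfl⟩ := hφ
  obtain ⟨θ, k, hθ, hk, rfl, rfl⟩ := hψ
  exact ⟨η + θ, g + k, fun t ↦ add_nonneg (hη t) (hθ t),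
    fun t ↦ add_mem_epsNormalSet (hx t) (hg t) (hk t), map_add _ _ _, map_add _ _ _⟩

theorem smul_mem_finiteNormalSums (hx : ∀ t, x ∈ C t) {a : ℝ} (ha : 0 ≤ a)
    (hφ : φ ∈ finiteNormalSums C x r) : a • φ ∈ finiteNormalSums C x (a * r) := by
  obtain ⟨A, η, hη, rfl, hφ⟩ := hφ
  obtain ⟨g, hg, rfl⟩ := (Set.mem_finsetSum _ _ _).1 hφ
  refine ⟨A, fun t ↦ a * η t, fun t ht ↦ mul_nonneg ha (hη t ht), (Finset.mul_sum _ _ _).symm, ?_⟩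
  rw [Finset.smul_sum]
  exact Set.finsetSum_mem_finsetSum _ _ _ fun t ht ↦ smul_mem_epsNormalSet (hx t) ha (hg ht)

theorem convex_finiteNormalSums (hx : ∀ t, x ∈ C t) : Convex ℝ (finiteNormalSums C x r) := by
  intro φ hφ ψ hψ a b ha hb hab
  have h := add_mem_finiteNormalSums hx (smul_mem_finiteNormalSums hx ha hφ)
    (smul_mem_finiteNormalSums hx hb hψ)
  rwa [← add_mul, hab, one_mul] at h

theorem apply_le_of_forall_finiteNormalSums_apply_le [IsTopologicalAddGroup X] [ContinuousSMul ℝ X]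
    [LocallyConvexSpace ℝ X] [Nonempty T] (hclosed : ∀ t, IsClosed (C t))
    (hconvex : ∀ t, Convex ℝ (C t)) (hx : x ∈ ⋂ t, C t) (hr : 0 < r)
    (hφ : φ ∈ epsNormalSet r (⋂ t, C t) x) {z : X} {c : ℝ}
    (hc : ∀ ψ ∈ finiteNormalSums C x r, ψ z ≤ c) : φ z ≤ c := by
  have hxC : ∀ t, x ∈ C t := Set.mem_iInter.1 hx
  have hψz (t : T) (ψ) (hψ : ψ ∈ epsNormalSet r (C t) x) : ψ z ≤ c :=
    hc ψ (epsNormalSet_subset_finiteNormalSums hr.le t hψ)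
  have hc_nonneg : 0 ≤ c :=
    hψz (Classical.arbitrary T) 0 (zero_mem_epsNormalSet (hxC _) hr.le)
  refine le_of_forall_gt_imp_ge_of_dense fun d hcd ↦ ?_
  have hd : 0 < d := hc_nonneg.trans_lt hcd
  have scale_le (χ : WeakDual ℝ X) : χ (x + (r / d) • z - x) ≤ r ↔ χ z ≤ d := by
    rw [add_sub_cancel_left, map_smul, smul_eq_mul, div_mul_eq_mul_div, div_le_iff₀ hd,
      mul_le_mul_iff_right₀ hr]
  have displaced_mem : x + (r / d) • z ∈ ⋂ t, C t := Set.mem_iInter.2 fun t ↦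
    (mem_iff_forall_epsNormalSet_apply_sub_le (hclosed t) (hconvex t) (hxC t) hr).2 fun ψ hψ ↦
      (scale_le ψ).2 ((hψz t ψ hψ).trans hcd.le)
  exact (scale_le φ).1 ((mem_epsNormalSet hx).1 hφ _ displaced_mem)

end FiniteNormalSums

section CompatibleTopology

variable {X : Type*} [AddCommGroup X] [Module ℝ X] [TopologicalSpace X]

theorem isCompatibleTopology_weakDual :
    IsCompatibleTopology (inferInstance : TopologicalSpace (WeakDual ℝ X)) where
  addGroup := inferInstance
  smul := inferInstance
  locallyConvex := inferInstanceAs (LocallyConvexSpace ℝ (WeakBilin (topDualPairing ℝ X)))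
  dual Φ := by
    constructor
    · intro hΦ
      obtain ⟨x, hx⟩ := LinearMap.dualEmbedding_surjective (topDualPairing ℝ X) ⟨Φ, hΦ⟩
      exact ⟨x, fun φ ↦ (DFunLike.congr_fun hx φ).symm⟩
    · rintro ⟨x, hx⟩
      exact (WeakDual.eval_continuous x).congr fun φ ↦ (hx φ).symm

variable {σ : TopologicalSpace (WeakDual ℝ X)}

theorem IsCompatibleTopology.mem_closure_iff_forall_apply_le (hσ : IsCompatibleTopology σ)
    {S : Set (WeakDual ℝ X)} (hS : Convex ℝ S) {φ : WeakDual ℝ X} :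
    φ ∈ closure[σ] S ↔ ∀ (z : X) (c : ℝ), (∀ ψ ∈ S, ψ z ≤ c) → φ z ≤ c := by
  have := hσ.addGroup
  have := hσ.smul
  have := hσ.locallyConvex
  rw [@mem_closure_iff_forall_continuous_linearMap_le _ _ _ σ _ _ _ _ hS]
  constructor
  · exact fun h z ↦ h ((topDualPairing ℝ X).flip z) ((hσ.dual _).2 ⟨z, fun _ ↦ rfl⟩)
  · intro h Φ hΦ
    obtain ⟨z, hz⟩ := (hσ.dual Φ).1 hΦ
    simpa only [hz] using h z

theorem IsCompatibleTopology.closure_finiteNormalSums [IsTopologicalAddGroup X]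
    [ContinuousSMul ℝ X] [LocallyConvexSpace ℝ X] (hσ : IsCompatibleTopology σ)
    {T : Type*} [Nonempty T] {C : T → Set X} (hclosed : ∀ t, IsClosed (C t))
    (hconvex : ∀ t, Convex ℝ (C t)) {x : X} (hx : x ∈ ⋂ t, C t) {r : ℝ} (hr : 0 < r) :
    closure[σ] (finiteNormalSums C x r) = epsNormalSet r (⋂ t, C t) x := by
  ext φ
  rw [hσ.mem_closure_iff_forall_apply_le (convex_finiteNormalSums (Set.mem_iInter.1 hx))]
  constructor
  · refine fun h ↦ (mem_epsNormalSet hx).2 fun y hy ↦ h (y - x) r fun ψ hψ ↦ ?_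
    exact (mem_epsNormalSet hx).1 (finiteNormalSums_subset_epsNormalSet_iInter hx hψ) y hy
  · exact fun hφ z c hc ↦ apply_le_of_forall_finiteNormalSums_apply_le hclosed hconvex hx hr hφ hc

theorem mainTheorem8_general [IsTopologicalAddGroup X] [ContinuousSMul ℝ X]
    [LocallyConvexSpace ℝ X] (hσ : IsCompatibleTopology σ)
    {T : Type*} [Nonempty T] {C : T → Set X} (hclosed : ∀ t, IsClosed (C t))
    (hconvex : ∀ t, Convex ℝ (C t)) {ε : ℝ} (hε : 0 ≤ ε) {x : X} (hx : x ∈ ⋂ t, C t) :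
    epsNormalSet ε (⋂ t, C t) x =
      ⋂ γ : ℝ, ⋂ _ : 0 < γ, closure[σ] (finiteNormalSums C x (ε + γ)) :=
  calc
    epsNormalSet ε (⋂ t, C t) x
      = ⋂ γ : ℝ, ⋂ _ : 0 < γ, epsNormalSet (ε + γ) (⋂ t, C t) x :=
        epsSubdifferential_eq_iInter_add ε _ x
    _ = ⋂ γ : ℝ, ⋂ _ : 0 < γ, closure[σ] (finiteNormalSums C x (ε + γ)) :=
        Set.iInter₂_congr fun _ hγ ↦
          (hσ.closure_finiteNormalSums hclosed hconvex hx (add_pos_of_nonneg_of_pos hε hγ)).symm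

end CompatibleTopology

theorem mainTheorem8 {X : Type*} [AddCommGroup X] [Module ℝ X] [TopologicalSpace X]
    [IsTopologicalAddGroup X] [ContinuousSMul ℝ X] [LocallyConvexSpace ℝ X] [T2Space X]
    {T : Type*} [Nonempty T] (C : T → Set X)
    (hclosed : ∀ t, IsClosed (C t)) (hconvex : ∀ t, Convex ℝ (C t))
    (ε : ℝ) (hε : 0 ≤ ε) (x : X) (hx : x ∈ ⋂ t, C t) :
    (epsNormalSet ε (⋂ t, C t) x =
      ⋂ γ : ℝ, ⋂ _ : 0 < γ, closure (finiteNormalSums C x (ε + γ))) ∧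
    (∀ σ : TopologicalSpace (WeakDual ℝ X), IsCompatibleTopology σ →
      epsNormalSet ε (⋂ t, C t) x =
        ⋂ γ : ℝ, ⋂ _ : 0 < γ, closure[σ] (finiteNormalSums C x (ε + γ))) :=
  ⟨mainTheorem8_general isCompatibleTopology_weakDual hclosed hconvex hε hx,
    fun _ hσ ↦ mainTheorem8_general hσ hclosed hconvex hε hx⟩
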